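/- Let $(N,E)$ be a finite connected graph whose lines $E\subseteq N\times N$ carry an arbitrary orientation ($(i,j)\in E\Rightarrow (j,i)\notin E$). Let $B_{ij}>0$ for $(i,j)\in E$ and, for $j\in N$, let $M_j,\tau^M_j,A_j,\alpha_j,\overline d_j>0$, $p^L_j\in\mathbb R$ and $\omega^1_j>\omega^0_j>0$. The states are $\zeta=(x,\sigma)$ with $x=(\eta,\omega,p^M)\in\mathbb R^{|E|+2|N|}$ and $\sigma\in\{0,1\}^{N}$; write $\Lambda=\mathbb R^{|E|+2|N|}\times\{0,1\}^{N}$. Consider the hybrid system $$\dot\zeta=f(\zeta),\ \zeta\in C,\qquad \zeta^+=g(\zeta),\ \zeta\in D,$$ where: - the flow $\dot\zeta=f(\zeta)$ is $$\dot\eta_{ij}=\omega_i-\omega_j,\quad M_j\dot\omega_j=-p^L_j+p^M_j-(\overline d_j\sigma_j+A_j\omega_j)-\sum_{k:(j,k)\in E}B_{jk}\eta_{jk}+\sum_{i:(i,j)\in E}B_{ij}\eta_{ij},$$ $$\tau^M_j\dot p^M_j=-(p^M_j+\alpha_j\omega_j),\quad \dot\sigma_j=0;$$ - $C$ is the set of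 $\zeta\in\Lambda$ such that for every $j$: $\sigma_j=1$ if $\omega_j>\omega^1_j$, and $\sigma_j=0$ if $\omega_j<\omega^0_j$; - $D=(\Lambda\setminus C)\cup\underline D$, where $\underline D$ is the set of $\zeta\in\Lambda$ such that for some $j$ either $\omega_j=\omega^1_j$ and $\sigma_j=0$, or $\omega_j=\omega^0_j$ and $\sigma_j=1$; - $g(x,\sigma)=(x,\sigma^+)$ with $\sigma^+_j=1$ if $\omega_j\ge\omega^1_j$, $\sigma^+_j=0$ if $\omega_j\le\omega^0_j$, and $\sigma^+_j=\sigma_j$ otherwise. A hybrid time domain is a set $K\subseteq\mathbb R_{\ge0}\times\mathbb N_0$ that is the union of an infinite or finite sequence of intervals $[t_l,t_{l+1}]\times\{l\}$, $0=t_0\le t_1\le\cdots$, where in the finite case the last interval may also be of the form $[t_l,T)\times\{l\}$ or $[t_l,\infty)\times\{l\}$; let $T_l=\{t:(t,l)\in K\}$. A solution is a function $\zeta(t,l)$ on a hybrid time domain $K$, locally absolutely continuous in $t$ on each $T_l$, such that $\zeta(0,0)\in C\cup D$; for each $l$ with $\operatorname{int}T_l\neq\emptyset$, $\zeta(t,l)\in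 C$ for all $t\in\operatorname{int}T_l$ and $\dot\zeta(t,l)=f(\zeta(t,l))$ for almost all $t\in T_l$; and $\zeta(t,l)\in D$, $\zeta(t,l+1)=g(\zeta(t,l))$ whenever $(t,l),(t,l+1)\in K$. It is complete if $K$ is unbounded, and maximal if it has no extension to a solution with a strictly larger time domain. Load $j$ switches at $(t,l)$ if $(t,l),(t,l+1)\in K$ and $\sigma_j(t,l)\ne\sigma_j(t,l+1)$; let $t_{1,j}\le t_{2,j}\le\cdots$ be the times of the successive switches of load $j$ (finitely or infinitely many, listed in the order of the jumps). Then: 1. For every $\zeta_0\in\Lambda$ there is a complete solution with $\zeta(0,0)=\zeta_0$. 2. Every maximal solution is complete. 3. For every complete bounded solution and every $j\in N$ there is $\tau_j>0$ such that $t_{i+1,j}-t_{i,j}\ge\tau_j$ for all $i\ge1$ for which both switches exist. -/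

import Mathlib

open Set MeasureTheory

noncomputable section

/-! ### Hybrid systems, hybrid time domains, solutions -/

/-- The data `(C, f, D, g)` of a hybrid system on `X` (single-valued flow and jump maps). -/
structure HybridSystem (X : Type*) where
  /-- flow set -/
  C : Set X
  /-- flow map; only its values on `C` matter -/
  f : X → X
  /-- jump set -/
  D : Set X
  /-- jump map; only its values on `D` matter -/
  g : X → X

/-- `K ⊆ ℝ≥0 × ℕ` is a hybrid time domain: with `0 = t 0 ≤ t 1 ≤ t 2 ≤ …`, it is either the union
of an infinite sequence of intervals `[t l, t (l+1)] × {l}`, or the union of finitely many such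
intervals (`l < J`) and a last nonempty interval `I × {J}` starting at `t J`, which is
`[t J, T]`, `[t J, T)` or `[t J, ∞)`. -/
def IsHybridTimeDomain (K : Set (ℝ × ℕ)) : Prop :=
  ∃ t : ℕ → ℝ, t 0 = 0 ∧ Monotone t ∧
    (K = ⋃ l : ℕ, Icc (t l) (t (l + 1)) ×ˢ {l} ∨
      ∃ (J : ℕ) (I : Set ℝ),
        ((∃ T, t J ≤ T ∧ I = Icc (t J) T) ∨ (∃ T, t J < T ∧ I = Ico (t J) T) ∨ I = Ici (t J)) ∧
        K = (⋃ l : ℕ, ⋃ _ : l < J, Icc (t l) (t (l + 1)) ×ˢ {l}) ∪ I ×ˢ {J})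

/-- The interval `T_l = {t : (t, l) ∈ K}`. -/
def timeSlice (K : Set (ℝ × ℕ)) (l : ℕ) : Set ℝ := {t | (t, l) ∈ K}

namespace HybridSystem

variable {X : Type*} [NormedAddCommGroup X] [NormedSpace ℝ X]

/-- `ζ`, restricted to `K`, is a solution of the hybrid system `H` with hybrid time domain `K`
(the values of `ζ` outside `K` are irrelevant). -/
structure IsSolution (H : HybridSystem X) (K : Set (ℝ × ℕ)) (ζ : ℝ → ℕ → X) : Prop where
  domain : IsHybridTimeDomain K
  /-- for every `l`, the map `t ↦ ζ t l` is locally absolutely continuous on `T_l` -/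
  locallyAC : ∀ l, ∀ a ∈ timeSlice K l, ∀ b ∈ timeSlice K l, a ≤ b →
    AbsolutelyContinuousOnInterval (fun t => ζ t l) a b
  initial : ζ 0 0 ∈ H.C ∪ H.D
  flow_mem : ∀ l, ∀ t ∈ interior (timeSlice K l), ζ t l ∈ H.C
  flow_eq : ∀ l, (interior (timeSlice K l)).Nonempty →
    ∀ᵐ t : ℝ, t ∈ timeSlice K l → HasDerivAt (fun s => ζ s l) (H.f (ζ t l)) t
  jump : ∀ t l, (t, l) ∈ K → (t, l + 1) ∈ K → ζ t l ∈ H.D ∧ ζ t (l + 1) = H.g (ζ t l)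

/-- A complete solution: its time domain is unbounded. -/
def IsCompleteSolution (H : HybridSystem X) (K : Set (ℝ × ℕ)) (ζ : ℝ → ℕ → X) : Prop :=
  H.IsSolution K ζ ∧ ¬ Bornology.IsBounded K

/-- A maximal solution: it has no extension to a solution with a strictly larger time domain. -/
def IsMaximalSolution (H : HybridSystem X) (K : Set (ℝ × ℕ)) (ζ : ℝ → ℕ → X) : Prop :=
  H.IsSolution K ζ ∧
    ¬ ∃ (K' : Set (ℝ × ℕ)) (ζ' : ℝ → ℕ → X), H.IsSolution K' ζ' ∧ K ⊂ K' ∧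
      ∀ t l, (t, l) ∈ K → ζ t l = ζ' t l

end HybridSystem

/-- `ζ`, defined on `K`, is bounded. -/
def IsBoundedArc {X : Type*} [NormedAddCommGroup X] (K : Set (ℝ × ℕ)) (ζ : ℝ → ℕ → X) : Prop :=
  Bornology.IsBounded ((fun q : ℝ × ℕ => ζ q.1 q.2) '' K)

/-! ### The power network with hysteretic loads -/

/-- A connected directed graph `(N, E)` (arbitrary orientation of the lines) with the parameters of
the generation, the demand and the hysteretic on-off loads. -/
structure PowerNetwork (N : Type*) where
  /-- transmission lines -/
  E : Finset (N × N)
  orientation : ∀ i j, (i, j) ∈ E → (j, i) ∉ E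
  connected : (SimpleGraph.fromRel fun i j => (i, j) ∈ E).Connected
  /-- line susceptances -/
  B : E → ℝ
  B_pos : ∀ e, 0 < B e
  /-- generator inertia -/
  M : N → ℝ
  M_pos : ∀ j, 0 < M j
  /-- generation time constants -/
  τ : N → ℝ
  τ_pos : ∀ j, 0 < τ j
  /-- damping coefficients -/
  A : N → ℝ
  A_pos : ∀ j, 0 < A j
  /-- droop coefficients -/
  α : N → ℝ
  α_pos : ∀ j, 0 < α j
  /-- frequency-independent load -/
  pL : N → ℝ
  /-- demand of the on-off load when switched on -/
  dbar : N → ℝ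
  dbar_pos : ∀ j, 0 < dbar j
  /-- lower (switch-off) frequency threshold -/
  ω0 : N → ℝ
  /-- upper (switch-on) frequency threshold -/
  ω1 : N → ℝ
  ω0_pos : ∀ j, 0 < ω0 j
  ω0_lt_ω1 : ∀ j, ω0 j < ω1 j

namespace PowerNetwork

variable {N : Type*} [Fintype N] [DecidableEq N] (W : PowerNetwork N)

/-- The continuous state `x = (η, ω, p^M)`, in `ℝ^n` with `n = |E| + 2|N|`. -/
abbrev ContState := (W.E → ℝ) × (N → ℝ) × (N → ℝ)

/-- The state `ζ = (x, σ)`. -/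
abbrev State := W.ContState × (N → ℝ)

variable {W}

/-- angle differences -/
def State.η (ζ : W.State) : W.E → ℝ := ζ.1.1
/-- frequencies -/
def State.ω (ζ : W.State) : N → ℝ := ζ.1.2.1
/-- mechanical power injections -/
def State.pM (ζ : W.State) : N → ℝ := ζ.1.2.2
/-- switching states of the loads -/
def State.σ (ζ : W.State) : N → ℝ := ζ.2

variable (W)

/-- The space `Λ = ℝ^n × {0,1}^N` in which the states evolve. -/
def Λ : Set W.State := {ζ | ∀ j, State.σ ζ j ∈ ({0, 1} : Set ℝ)}

/-- power transfer `p_ij = B_ij η_ij` -/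
def p (ζ : W.State) (e : W.E) : ℝ := W.B e * State.η ζ e

/-- The continuous dynamics `f`. -/
def flowMap (ζ : W.State) : W.State :=
  ((fun e => State.ω ζ e.1.1 - State.ω ζ e.1.2,
    fun j => (1 / W.M j) *
      (-W.pL j + State.pM ζ j - (W.dbar j * State.σ ζ j + W.A j * State.ω ζ j)
        - (∑ e : W.E with e.1.1 = j, W.p ζ e) + ∑ e : W.E with e.1.2 = j, W.p ζ e),
    fun j => (1 / W.τ j) * -(State.pM ζ j + W.α j * State.ω ζ j)),
   fun _ => 0)

/-- The set `𝓘_j(ω_j)` of admissible switching states during flow. -/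
def flowStates (j : N) (w : ℝ) : Set ℝ :=
  if W.ω1 j < w then {1} else if w < W.ω0 j then {0} else {0, 1}

/-- The flow set `C`. -/
def flowSet : Set W.State := {ζ ∈ W.Λ | ∀ j, State.σ ζ j ∈ W.flowStates j (State.ω ζ j)}

/-- The set `𝓘^D_j(ω_j)` of switching states which may change at a threshold; it is empty when
`ω_j` is not at a threshold. -/
def thresholdStates (j : N) (w : ℝ) : Set ℝ :=
  if w = W.ω1 j then {0} else if w = W.ω0 j then {1} else ∅

/-- States at which some load has reached the threshold for a switch. -/
def thresholdSet : Set W.State :=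
  {ζ ∈ W.Λ | ∃ j, State.σ ζ j ∈ W.thresholdStates j (State.ω ζ j)}

/-- The jump set `D`. -/
def jumpSet : Set W.State := (W.Λ \ W.flowSet) ∪ W.thresholdSet

/-- The discrete update `g`: `x` is unchanged, each load switches on if `ω_j ≥ ω_j^1`, off if
`ω_j ≤ ω_j^0`, and keeps its switching state strictly between the thresholds. -/
def jumpMap (ζ : W.State) : W.State :=
  (ζ.1, fun j =>
    if W.ω1 j ≤ State.ω ζ j then 1 else if State.ω ζ j ≤ W.ω0 j then 0 else State.σ ζ j)

/-- The hysteretic hybrid system of the network. -/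
def hystereticSystem : HybridSystem W.State where
  C := W.flowSet
  f := W.flowMap
  D := W.jumpSet
  g := W.jumpMap

variable {W}

/-- Load `j` switches at the hybrid time `(t, l)`: the value of `σ_j` changes in the jump from
`(t, l)` to `(t, l + 1)`. -/
def IsSwitch (K : Set (ℝ × ℕ)) (ζ : ℝ → ℕ → W.State) (j : N) (t : ℝ) (l : ℕ) : Prop :=
  (t, l) ∈ K ∧ (t, l + 1) ∈ K ∧ State.σ (ζ t l) j ≠ State.σ (ζ t (l + 1)) j

/-- `s` and `t` are the times of two consecutive switches of load `j` (a pair `t_{i,j}`,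
`t_{i+1,j}`). -/
def AreConsecutiveSwitchTimes (K : Set (ℝ × ℕ)) (ζ : ℝ → ℕ → W.State) (j : N) (s t : ℝ) : Prop :=
  ∃ l m : ℕ, l < m ∧ IsSwitch K ζ j s l ∧ IsSwitch K ζ j t m ∧
    ∀ k r, l < k → k < m → ¬ IsSwitch K ζ j r k

end PowerNetwork

end

/-! The flow map is affine, so every state has a global classical flow, and along it `σ` is
constant. By uniqueness, each slice of a locally absolutely continuous solution is a piece of that
flow (`eq_flow_of_isSolution`). Within `Λ` the jump set is given by non-strict inequalities
(`mem_jumpSet_iff`), so it is closed along the flow, and whatever lies outside it lies in the flow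
set.

Existence: flow until the first hitting time of the jump set, jump, repeat. `Λ` is preserved, and
either some flow phase lasts forever or there are infinitely many jumps, so the domain is unbounded
either way.

Maximality: on a bounded domain the last interval is bounded. A half-open one can be closed, since
the flow has no blow-up. A closed one can be continued by a jump if its endpoint is in the jump set,
and by a short flow otherwise, by closedness.

Dwell time: on a bounded solution the vector field is bounded, say by `c`, and jumps do not move
`ω`. Consecutive switches of load `j` have opposite directions, so `ω_j` must cross the band between
the two thresholds, which takes at least `(ω1 j - ω0 j) / c`. -/

/-! ### Global affine flows and uniqueness for absolutely continuous solutions -/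

/-- The affine autonomous ODE `x' = L x + b` has a global solution for every initial value. -/
theorem exists_forall_hasDerivAt_affine {E : Type*} [NormedAddCommGroup E] [NormedSpace ℝ E]
    [CompleteSpace E] (L : E →L[ℝ] E) (b x : E) :
    ∃ φ : ℝ → E, φ 0 = x ∧ ∀ t, HasDerivAt φ (L (φ t) + b) t := by
  have hexp : ∀ t : ℝ, HasDerivAt (fun u : ℝ => NormedSpace.exp (u • L) (L x + b))
      (L (NormedSpace.exp (t • L) (L x + b))) t := fun t => by
    simpa using (hasDerivAt_exp_smul_const' L t).clm_apply (hasDerivAt_const t (L x + b))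
  have hcont : Continuous fun u : ℝ => NormedSpace.exp (u • L) (L x + b) :=
    continuous_iff_continuousAt.2 fun t => (hexp t).continuousAt
  have hder : ∀ t, HasDerivAt (fun t => x + ∫ s in (0 : ℝ)..t, NormedSpace.exp (s • L) (L x + b))
      (NormedSpace.exp (t • L) (L x + b)) t := fun t =>
    (intervalIntegral.integral_hasDerivAt_right (hcont.intervalIntegrable _ _)
      (hcont.stronglyMeasurableAtFilter _ _) hcont.continuousAt).const_add x
  -- The velocity `v = φ'` must solve `v' = L v` with `v 0 = L x + b`. Integrating it gives `φ`
  -- without inverting `L`.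
  refine ⟨fun t => x + ∫ s in (0 : ℝ)..t, NormedSpace.exp (s • L) (L x + b), by simp,
    fun t => ?_⟩
  convert hder t using 1
  have h1 : (∫ s in (0 : ℝ)..t, L (NormedSpace.exp (s • L) (L x + b)))
      = NormedSpace.exp (t • L) (L x + b) - (L x + b) := by
    rw [intervalIntegral.integral_eq_sub_of_hasDerivAt (fun s _ => hexp s)
      ((L.continuous.comp hcont).intervalIntegrable _ _)]
    simp
  rw [L.intervalIntegral_comp_comm (hcont.intervalIntegrable _ _)] at h1
  rw [map_add, h1]
  abel

/-- A locally absolutely continuous solution of an ODE with Lipschitz right-hand side coincides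
with the classical one. -/
theorem AbsolutelyContinuousOnInterval.eqOn_of_ae_hasDerivAt {E : Type*} [NormedAddCommGroup E]
    [NormedSpace ℝ E] [CompleteSpace E] {f : E → E} {c : NNReal} (hf : LipschitzWith c f)
    {z φ : ℝ → E} {a b : ℝ} (hab : a ≤ b) (hz : AbsolutelyContinuousOnInterval z a b)
    (hz' : ∀ᵐ t : ℝ, t ∈ Icc a b → HasDerivAt z (f (z t)) t)
    (hφ : ∀ t, HasDerivAt φ (f (φ t)) t) (ha : z a = φ a) : EqOn z φ (Icc a b) := by
  have hzc : ContinuousOn z (Icc a b) := by simpa [uIcc_of_le hab] using hz.continuousOn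
  -- Extending `f ∘ z` continuously to all of `ℝ` makes its primitive `y` of class C¹. Then `z - y`
  -- is absolutely continuous with zero derivative a.e., hence constant, so `z` satisfies the ODE
  -- everywhere and classical uniqueness applies.
  set F : ℝ → E := IccExtend hab ((Icc a b).domRestrict fun t => f (z t)) with hF
  have hFc : Continuous F :=
    (continuousOn_iff_continuous_domRestrict.1 (hf.continuous.comp_continuousOn hzc)).Icc_extend'
  have hFeq : ∀ t ∈ Icc a b, F t = f (z t) := fun t ht => by
    rw [hF, IccExtend_of_mem hab _ ht]; rfl
  set y : ℝ → E := fun t => ∫ s in a..t, F s with hy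
  have hyd : ∀ t, HasDerivAt y (F t) t := fun t =>
    intervalIntegral.integral_hasDerivAt_right (hFc.intervalIntegrable _ _)
      (hFc.stronglyMeasurableAtFilter _ _) hFc.continuousAt
  have hyC : ContDiff ℝ 1 y := by
    refine contDiff_one_iff_deriv.2 ⟨fun t => (hyd t).differentiableAt, ?_⟩
    rwa [show deriv y = F from funext fun t => (hyd t).deriv]
  obtain ⟨C, hC⟩ := (hz.sub hyC.contDiffOn.absolutelyContinuousOnInterval
    ).const_of_ae_hasDerivAt_zero (by
      filter_upwards [hz'] with t ht hta
      rw [uIcc_of_le hab] at hta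
      simpa [hFeq t hta] using (ht hta).sub (hyd t))
  rw [uIcc_of_le hab] at hC
  have hzy : EqOn z (fun t => C + y t) (Icc a b) := fun t ht => by
    rw [← hC t ht]; simp
  refine ODE_solution_unique (v := fun _ => f) (fun _ => hf) hzc (fun t ht => ?_)
    (HasDerivAt.continuousOn fun t _ => hφ t) (fun t _ => (hφ t).hasDerivWithinAt) ha
  have h1 : HasDerivWithinAt (fun t => C + y t) (f (z t)) (Icc a b) t := by
    rw [← hFeq t (Ico_subset_Icc_self ht)]
    exact ((hyd t).const_add C).hasDerivWithinAt
  exact (h1.congr hzy (hzy (Ico_subset_Icc_self ht))).mono_of_mem_nhdsWithin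
    (Icc_mem_nhdsGE_of_mem ht)

theorem absolutelyContinuousOnInterval_of_hasDerivAt {E : Type*} [NormedAddCommGroup E]
    [NormedSpace ℝ E] {f : E → E} (hf : Continuous f) {φ : ℝ → E}
    (hφ : ∀ t, HasDerivAt φ (f (φ t)) t) (a b : ℝ) : AbsolutelyContinuousOnInterval φ a b := by
  refine ContDiffOn.absolutelyContinuousOnInterval (ContDiff.contDiffOn ?_)
  refine contDiff_one_iff_deriv.2 ⟨fun t => (hφ t).differentiableAt, ?_⟩
  rw [show deriv φ = fun t => f (φ t) from funext fun t => (hφ t).deriv]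
  exact hf.comp (continuous_iff_continuousAt.2 fun t => (hφ t).continuousAt)

/-! ### Hybrid time domains -/

/-- The three shapes of the last interval matter only through order-connectedness and having `t J`
as least element. -/
theorem IsHybridTimeDomain.exists_mem_iff {K : Set (ℝ × ℕ)} (hK : IsHybridTimeDomain K) :
    ∃ t : ℕ → ℝ, t 0 = 0 ∧ Monotone t ∧
      ((∀ s l, (s, l) ∈ K ↔ t l ≤ s ∧ s ≤ t (l + 1)) ∨
        ∃ (J : ℕ) (I : Set ℝ), I.OrdConnected ∧ t J ∈ I ∧ I ⊆ Ici (t J) ∧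
          ∀ s l, (s, l) ∈ K ↔ (l < J ∧ t l ≤ s ∧ s ≤ t (l + 1)) ∨ (l = J ∧ s ∈ I)) := by
  obtain ⟨t, h0, hm, rfl | ⟨J, I, hI, rfl⟩⟩ := hK
  · exact ⟨t, h0, hm, Or.inl fun s l => by simp⟩
  · refine ⟨t, h0, hm, Or.inr ⟨J, I, ?_, ?_, ?_, fun s l => by simp; tauto⟩⟩
    · obtain ⟨T, -, rfl⟩ | ⟨T, -, rfl⟩ | rfl := hI
      exacts [ordConnected_Icc, ordConnected_Ico, ordConnected_Ici]
    · obtain ⟨T, h, rfl⟩ | ⟨T, h, rfl⟩ | rfl := hI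
      exacts [left_mem_Icc.2 h, left_mem_Ico.2 h, self_mem_Ici]
    · obtain ⟨T, h, rfl⟩ | ⟨T, h, rfl⟩ | rfl := hI
      exacts [Icc_subset_Ici_self, Ico_subset_Ici_self, subset_rfl]

theorem IsHybridTimeDomain.ordConnected {K : Set (ℝ × ℕ)} (hK : IsHybridTimeDomain K) (l : ℕ) :
    (timeSlice K l).OrdConnected := by
  obtain ⟨t, h0, hm, h | ⟨J, I, hI, -, -, h⟩⟩ := hK.exists_mem_iff
  · convert ordConnected_Icc (a := t l) (b := t (l + 1)) using 1
    ext s; simp [timeSlice, h]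
  · refine ⟨fun a ha b hb c hc => ?_⟩
    simp only [timeSlice, mem_ofPred_eq, h] at *
    rcases ha with ha | ha <;> rcases hb with hb | hb
    · exact Or.inl ⟨ha.1, ha.2.1.trans hc.1, hc.2.trans hb.2.2⟩
    · omega
    · omega
    · exact Or.inr ⟨ha.1, hI.out ha.2 hb.2 hc⟩

theorem IsHybridTimeDomain.zero_mem {K : Set (ℝ × ℕ)} (hK : IsHybridTimeDomain K) {t : ℝ}
    (ht : (t, 0) ∈ K) : 0 ≤ t ∧ (0, 0) ∈ K := by
  obtain ⟨u, h0, hm, h | ⟨J, I, hI, hJ, hs, h⟩⟩ := hK.exists_mem_iff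
  · have := hm (Nat.zero_le 1)
    simp_all
  · have := hm (Nat.zero_le 1)
    simp only [h] at ht ⊢
    rcases ht with ht | ⟨rfl, ht⟩
    · exact ⟨h0 ▸ ht.2.1, Or.inl ⟨ht.1, h0.le, by simpa [h0] using this⟩⟩
    · exact ⟨h0 ▸ hs ht, Or.inr ⟨rfl, h0 ▸ hJ⟩⟩

theorem IsHybridTimeDomain.exists_jump {K : Set (ℝ × ℕ)} (hK : IsHybridTimeDomain K) {t : ℝ}
    {l : ℕ} (ht : (t, l + 1) ∈ K) : ∃ s ≤ t, (s, l) ∈ K ∧ (s, l + 1) ∈ K := by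
  obtain ⟨u, h0, hm, h | ⟨J, I, hI, hJ, hs, h⟩⟩ := hK.exists_mem_iff
  · simp only [h] at ht ⊢
    exact ⟨u (l + 1), ht.1, ⟨hm (Nat.le_succ l), le_rfl⟩, le_rfl, hm (Nat.le_succ _)⟩
  · have h1 := hm (Nat.le_succ l)
    have h2 := hm (Nat.le_succ (l + 1))
    simp only [h] at ht ⊢
    rcases ht with ht | ⟨rfl, ht⟩
    · exact ⟨u (l + 1), ht.2.1, Or.inl ⟨by omega, h1, le_rfl⟩, Or.inl ⟨ht.1, le_rfl, h2⟩⟩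
    · exact ⟨u (l + 1), hs ht, Or.inl ⟨by omega, h1, le_rfl⟩, Or.inr ⟨rfl, hJ⟩⟩

theorem IsHybridTimeDomain.le_of_jump {K : Set (ℝ × ℕ)} (hK : IsHybridTimeDomain K) {s t : ℝ}
    {l : ℕ} (hs : (s, l) ∈ K) (ht : (t, l + 1) ∈ K) : s ≤ t := by
  obtain ⟨u, h0, hm, h | ⟨J, I, hI, hJ, hs', h⟩⟩ := hK.exists_mem_iff
  · simp only [h] at hs ht
    exact hs.2.trans ht.1
  · simp only [h] at hs ht
    rcases ht with ht | ⟨rfl, ht⟩ <;> rcases hs with hs | hs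
    · exact hs.2.2.trans ht.2.1
    · omega
    · exact hs.2.2.trans (hs' ht)
    · omega

theorem exists_bound_of_isBounded {K : Set (ℝ × ℕ)} (hK : Bornology.IsBounded K) :
    ∃ R : ℝ, ∀ t l, (t, l) ∈ K → t ≤ R ∧ (l : ℝ) ≤ R := by
  obtain ⟨R, hR⟩ := (Metric.isBounded_iff_subset_closedBall (0, 0)).1 hK
  refine ⟨R, fun t l h => ?_⟩
  have := hR h
  rw [Metric.mem_closedBall, Prod.dist_eq, max_le_iff] at this
  exact ⟨(le_abs_self t).trans (by simpa using this.1), by simpa [Nat.dist_eq] using this.2⟩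

theorem not_isBounded_of_forall_mem {K : Set (ℝ × ℕ)} {t : ℕ → ℝ} (h : ∀ l, (t l, l) ∈ K) :
    ¬ Bornology.IsBounded K := fun hK => by
  obtain ⟨R, hR⟩ := exists_bound_of_isBounded hK
  obtain ⟨n, hn⟩ := exists_nat_gt R
  exact absurd (hR _ _ (h n)).2 (not_le.2 hn)

theorem not_isBounded_of_Ici_subset {K : Set (ℝ × ℕ)} {a : ℝ} {l : ℕ}
    (h : ∀ t, a ≤ t → (t, l) ∈ K) : ¬ Bornology.IsBounded K := fun hK => by
  obtain ⟨R, hR⟩ := exists_bound_of_isBounded hK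
  linarith [(hR _ _ (h (max a (R + 1)) (le_max_left _ _))).1, le_max_right a (R + 1)]

/-- On each slice a solution coincides with any classical solution that it meets. -/
theorem HybridSystem.IsSolution.eqOn_flow {X : Type*} [NormedAddCommGroup X] [NormedSpace ℝ X]
    [CompleteSpace X] {H : HybridSystem X} {K : Set (ℝ × ℕ)} {ζ : ℝ → ℕ → X}
    (h : H.IsSolution K ζ) {c : NNReal} (hf : LipschitzWith c H.f) {a b : ℝ} {l : ℕ}
    (ha : (a, l) ∈ K) (hb : (b, l) ∈ K) (hab : a ≤ b) {φ : ℝ → X}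
    (hφ : ∀ t, HasDerivAt φ (H.f (φ t)) t) (h0 : ζ a l = φ a) :
    EqOn (fun t => ζ t l) φ (Icc a b) := by
  have hsub : Icc a b ⊆ timeSlice K l := (h.domain.ordConnected l).out ha hb
  rcases hab.eq_or_lt with rfl | hlt
  · simpa using h0
  · refine (h.locallyAC l a ha b hb hab).eqOn_of_ae_hasDerivAt hf hab ?_ hφ h0
    have hne : (interior (timeSlice K l)).Nonempty :=
      (nonempty_Ioo.2 hlt).mono
        (interior_maximal (Ioo_subset_Icc_self.trans hsub) isOpen_Ioo)
    filter_upwards [h.flow_eq l hne] with t ht hta using ht (hsub hta)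

/-! ### Geometry of the flow and jump sets -/

namespace PowerNetwork

variable {N : Type*} {W : PowerNetwork N}

theorem jumpMap_mem_Λ {ζ : W.State} (h : ζ ∈ W.Λ) : W.jumpMap ζ ∈ W.Λ := fun j => by
  have := h j
  simp only [jumpMap, State.σ] at *
  split_ifs <;> simp_all

/-- Leaving the flow set gives the strict inequalities and the threshold set adds the equality
cases, so the union is described by closed conditions. Since `ω0 j < ω1 j`, the order of the nested
conditionals is immaterial. -/
theorem mem_jumpSet_iff {ζ : W.State} (h : ζ ∈ W.Λ) : ζ ∈ W.jumpSet ↔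
    ∃ j, State.σ ζ j = 1 ∧ State.ω ζ j ≤ W.ω0 j ∨ State.σ ζ j = 0 ∧ W.ω1 j ≤ State.ω ζ j := by
  have key : ∀ j, (State.σ ζ j ∉ W.flowStates j (State.ω ζ j) ∨
      State.σ ζ j ∈ W.thresholdStates j (State.ω ζ j)) ↔
      (State.σ ζ j = 1 ∧ State.ω ζ j ≤ W.ω0 j ∨ State.σ ζ j = 0 ∧ W.ω1 j ≤ State.ω ζ j) := by
    intro j
    have h1 := W.ω0_lt_ω1 j
    have h2 := h j
    simp only [mem_insert_iff, mem_singleton_iff] at h2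
    simp only [flowStates, thresholdStates]
    rcases h2 with h2 | h2 <;> rw [h2] <;> split_ifs <;> simp <;> grind
  simp only [jumpSet, thresholdSet, flowSet, mem_union, mem_sdiff, mem_ofPred_eq, h, true_and,
    ← key, exists_or, not_forall]

theorem mem_flowSet_of_notMem_jumpSet {ζ : W.State} (h : ζ ∈ W.Λ) (hD : ζ ∉ W.jumpSet) :
    ζ ∈ W.flowSet := by
  by_contra hC
  exact hD (Or.inl ⟨h, hC⟩)

theorem flowSet_union_jumpSet : W.flowSet ∪ W.jumpSet = W.Λ := by
  ext ζ
  refine ⟨fun h => ?_, fun h => ?_⟩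
  · rcases h with h | h | h
    exacts [h.1, h.1, h.1]
  · by_cases hD : ζ ∈ W.jumpSet
    exacts [Or.inr hD, Or.inl (mem_flowSet_of_notMem_jumpSet h hD)]

variable [Fintype N]

theorem isClosed_setOf_mem_jumpSet {φ : ℝ → W.State} (hφ : Continuous φ)
    (hΛ : ∀ t, φ t ∈ W.Λ) : IsClosed {t | φ t ∈ W.jumpSet} := by
  have hω : ∀ j, Continuous fun t => State.ω (φ t) j := fun j => by
    simp only [State.ω]; fun_prop
  have hσ : ∀ j, Continuous fun t => State.σ (φ t) j := fun j => by
    simp only [State.σ]; fun_prop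
  have : {t | φ t ∈ W.jumpSet} = ⋃ j, ({t | State.σ (φ t) j = 1 ∧ State.ω (φ t) j ≤ W.ω0 j} ∪
      {t | State.σ (φ t) j = 0 ∧ W.ω1 j ≤ State.ω (φ t) j}) := by
    ext t
    simp [mem_jumpSet_iff (hΛ t)]
  rw [this]
  exact isClosed_iUnion_of_finite fun j =>
    ((isClosed_eq (hσ j) continuous_const).inter (isClosed_le (hω j) continuous_const)).union
      ((isClosed_eq (hσ j) continuous_const).inter (isClosed_le continuous_const (hω j)))

/-- Along the flow from a state of `Λ`, either the jump set is never met, or there is a first time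
at which it is met. -/
theorem exists_hitting_time {φ : ℝ → W.State} (hφ : Continuous φ) (hΛ : ∀ t, φ t ∈ W.Λ) :
    ∃ T : ℝ, 0 ≤ T ∧ ((∀ t, 0 ≤ t → φ t ∈ W.flowSet) ∨
      (∀ t ∈ Ioo 0 T, φ t ∈ W.flowSet) ∧ φ T ∈ W.jumpSet) := by
  by_cases hne : ({t | φ t ∈ W.jumpSet} ∩ Ici 0).Nonempty
  · have hbdd : BddBelow ({t | φ t ∈ W.jumpSet} ∩ Ici 0) := bddBelow_Ici.mono inter_subset_right
    -- Closedness makes the infimum of the hitting times an actual hitting time, possibly `0`.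
    obtain ⟨h1, h2⟩ := ((isClosed_setOf_mem_jumpSet hφ hΛ).inter isClosed_Ici).csInf_mem hne hbdd
    exact ⟨_, h2, Or.inr ⟨fun t ht => mem_flowSet_of_notMem_jumpSet (hΛ t) fun hD =>
      absurd (csInf_le hbdd ⟨hD, ht.1.le⟩) (not_le.2 ht.2), h1⟩⟩
  · exact ⟨0, le_rfl, Or.inl fun t ht => mem_flowSet_of_notMem_jumpSet (hΛ t) fun hD =>
      hne ⟨t, hD, ht⟩⟩

/-! ### The classical flow of the network -/

variable (W) [DecidableEq N]

theorem exists_flowMap_eq_add :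
    ∃ L : W.State →L[ℝ] W.State, ∀ ζ, W.flowMap ζ = L ζ + W.flowMap 0 := by
  let L : W.State →ₗ[ℝ] W.State :=
    { toFun := fun ζ => W.flowMap ζ - W.flowMap 0
      map_add' := fun x y => by
        refine Prod.ext (Prod.ext ?_ (Prod.ext ?_ ?_)) ?_ <;> funext j <;>
          simp [flowMap, State.η, State.ω, State.pM, State.σ, p, mul_add, Finset.sum_add_distrib] <;>
          ring
      map_smul' := fun c x => by
        refine Prod.ext (Prod.ext ?_ (Prod.ext ?_ ?_)) ?_ <;> funext j <;>
          simp [flowMap, State.η, State.ω, State.pM, State.σ, p, mul_left_comm _ c,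
            ← Finset.mul_sum] <;>
          ring }
  exact ⟨LinearMap.toContinuousLinearMap L, fun ζ => by simp [L]⟩

theorem exists_lipschitzWith_flowMap : ∃ c, LipschitzWith c W.flowMap := by
  obtain ⟨L, hL⟩ := W.exists_flowMap_eq_add
  refine ⟨‖L‖₊, LipschitzWith.of_dist_le_mul fun x y => ?_⟩
  rw [hL x, hL y, dist_add_right]
  exact L.lipschitz.dist_le_mul x y

theorem exists_flow (ζ : W.State) :
    ∃ φ : ℝ → W.State, φ 0 = ζ ∧ ∀ t, HasDerivAt φ (W.flowMap (φ t)) t := by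
  obtain ⟨L, hL⟩ := W.exists_flowMap_eq_add
  obtain ⟨φ, h0, h⟩ := exists_forall_hasDerivAt_affine L (W.flowMap 0) ζ
  exact ⟨φ, h0, fun t => hL _ ▸ h t⟩

variable {W}

theorem switching_eq_of_hasDerivAt {φ : ℝ → W.State}
    (hφ : ∀ t, HasDerivAt φ (W.flowMap (φ t)) t) (s t : ℝ) : (φ s).2 = (φ t).2 := by
  have h : ∀ t, HasDerivAt (fun t => (φ t).2) 0 t := fun t =>
    (hφ t).hasFDerivAt.snd.hasDerivAt.congr_deriv (by
      rw [ContinuousLinearMap.comp_apply, ContinuousLinearMap.toSpanSingleton_apply, one_smul]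
      rfl)
  exact is_const_of_deriv_eq_zero (fun t => (h t).differentiableAt) (fun t => (h t).deriv) s t

theorem mem_Λ_of_hasDerivAt {φ : ℝ → W.State}
    (hφ : ∀ t, HasDerivAt φ (W.flowMap (φ t)) t) {s : ℝ} (hs : φ s ∈ W.Λ) (t : ℝ) :
    φ t ∈ W.Λ := fun j => by
  simpa [State.σ, switching_eq_of_hasDerivAt hφ t s] using hs j

/-! ### Construction of complete solutions -/

/-- From every state of `Λ` there is a complete solution. -/
theorem exists_isCompleteSolution {ζ₀ : W.State} (h₀ : ζ₀ ∈ W.Λ) :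
    ∃ (K : Set (ℝ × ℕ)) (ζ : ℝ → ℕ → W.State),
      W.hystereticSystem.IsCompleteSolution K ζ ∧ ζ 0 0 = ζ₀ := by
  choose Φ hΦ0 hΦ using W.exists_flow
  have hΦc : ∀ x, Continuous (Φ x) := fun x =>
    continuous_iff_continuousAt.2 fun t => (hΦ x t).continuousAt
  have hΦΛ : ∀ x ∈ W.Λ, ∀ t, Φ x t ∈ W.Λ := fun x hx =>
    mem_Λ_of_hasDerivAt (hΦ x) (s := 0) (by rwa [hΦ0])
  have hT : ∀ x, ∃ T : ℝ, 0 ≤ T ∧ (x ∈ W.Λ → (∀ t, 0 ≤ t → Φ x t ∈ W.flowSet) ∨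
      (∀ t ∈ Ioo 0 T, Φ x t ∈ W.flowSet) ∧ Φ x T ∈ W.jumpSet) := fun x => by
    by_cases hx : x ∈ W.Λ
    · obtain ⟨T, h1, h2⟩ := exists_hitting_time (hΦc x) (hΦΛ x hx)
      exact ⟨T, h1, fun _ => h2⟩
    · exact ⟨0, le_rfl, fun h => absurd h hx⟩
  choose T hT0 hT using hT
  -- `s l` is the state at the start of the `l`-th flow phase, and `t l` below is the sum of the
  -- preceding durations. Phases of zero length are allowed.
  let s : ℕ → W.State := fun n => Nat.rec ζ₀ (fun _ x => W.jumpMap (Φ x (T x))) n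
  have hs1 : ∀ l, s (l + 1) = W.jumpMap (Φ (s l) (T (s l))) := fun l => rfl
  have hsΛ : ∀ l, s l ∈ W.Λ := fun l => by
    induction l with
    | zero => exact h₀
    | succ l ih => exact jumpMap_mem_Λ (hΦΛ _ ih _)
  let t : ℕ → ℝ := fun l => ∑ i ∈ Finset.range l, T (s i)
  have ht0 : t 0 = 0 := by simp [t]
  have ht1 : ∀ l, t (l + 1) = t l + T (s l) := fun l => Finset.sum_range_succ _ _
  have htm : Monotone t := monotone_nat_of_le_succ fun l => by
    rw [ht1]; linarith [hT0 (s l)]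
  have hder : ∀ l r, HasDerivAt (fun r => Φ (s l) (r - t l)) (W.flowMap (Φ (s l) (r - t l))) r :=
    fun l r => (hΦ (s l) (r - t l)).comp_sub_const r (t l)
  obtain ⟨c, hc⟩ := W.exists_lipschitzWith_flowMap
  -- The arc is the same in both cases below; only its time domain differs.
  have main : ∀ K, IsHybridTimeDomain K →
      (∀ l, ∀ r ∈ interior (timeSlice K l), Φ (s l) (r - t l) ∈ W.flowSet) →
      (∀ r l, (r, l) ∈ K → (r, l + 1) ∈ K → r = t (l + 1) ∧ Φ (s l) (T (s l)) ∈ W.jumpSet) →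
      W.hystereticSystem.IsSolution K fun r l => Φ (s l) (r - t l) := by
    intro K hK hC hJ
    refine ⟨hK, fun l a _ b _ _ =>
      absolutelyContinuousOnInterval_of_hasDerivAt hc.continuous (hder l) a b, ?_, hC,
      fun l _ => Filter.Eventually.of_forall fun r _ => hder l r, fun r l h1 h2 => ?_⟩
    · exact (flowSet_union_jumpSet (W := W)).symm ▸ hΦΛ _ (hsΛ 0) _
    · obtain ⟨rfl, hD⟩ := hJ r l h1 h2
      refine ⟨?_, ?_⟩
      · simpa [ht1, hystereticSystem] using hD
      · simp [hΦ0, hs1, ht1, hystereticSystem]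
  have hIoo : ∀ l, ∀ r ∈ Ioo (t l) (t (l + 1)), Φ (s l) (r - t l) ∈ W.flowSet := by
    intro l r hr
    rw [ht1] at hr
    rcases hT (s l) (hsΛ l) with h | h
    · exact h _ (by linarith [hr.1])
    · exact h.1 _ ⟨by linarith [hr.1], by linarith [hr.2]⟩
  -- If some phase can flow forever, the domain is cut at the first such index, so that all earlier
  -- phases end in the jump set. Otherwise there are infinitely many jumps, and the domain is
  -- unbounded in `l` even if the times `t l` stay bounded.
  by_cases hP : ∃ l, ∀ r, 0 ≤ r → Φ (s l) r ∈ W.flowSet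
  · classical
    set J := Nat.find hP
    have hJ := Nat.find_spec hP
    have hlt : ∀ l < J, Φ (s l) (T (s l)) ∈ W.jumpSet := fun l hl =>
      ((hT (s l) (hsΛ l)).resolve_left (Nat.find_min hP hl)).2
    set K : Set (ℝ × ℕ) :=
      (⋃ l : ℕ, ⋃ _ : l < J, Icc (t l) (t (l + 1)) ×ˢ {l}) ∪ Ici (t J) ×ˢ {J}
    have hmem : ∀ r l, (r, l) ∈ K ↔
        (l < J ∧ t l ≤ r ∧ r ≤ t (l + 1)) ∨ (l = J ∧ t J ≤ r) := fun r l => by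
      simp [K]; tauto
    refine ⟨K, fun r l => Φ (s l) (r - t l), ⟨main K
      ⟨t, ht0, htm, Or.inr ⟨J, Ici (t J), Or.inr (Or.inr rfl), rfl⟩⟩ ?_ ?_,
      not_isBounded_of_Ici_subset (a := t J) (l := J) fun r hr => (hmem r J).2 (Or.inr ⟨rfl, hr⟩)⟩,
      by simp [ht0, hΦ0, s]⟩
    · intro l r hr
      rcases lt_trichotomy l J with hl | rfl | hl
      · refine hIoo l r (interior_Icc (a := t l) ▸ interior_mono (fun q hq => ?_) hr)
        have := (hmem q l).1 hq
        grind
      · have := (hmem r J).1 (show r ∈ timeSlice K J from interior_subset hr)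
        exact hJ _ (by grind)
      · have := (hmem r l).1 (show r ∈ timeSlice K l from interior_subset hr)
        grind
    · intro r l h1 h2
      rw [hmem] at h1 h2
      have hl : l < J := by grind
      exact ⟨by grind, hlt l hl⟩
  · have hD : ∀ l, Φ (s l) (T (s l)) ∈ W.jumpSet := fun l =>
      ((hT (s l) (hsΛ l)).resolve_left fun h => hP ⟨l, h⟩).2
    set K : Set (ℝ × ℕ) := ⋃ l : ℕ, Icc (t l) (t (l + 1)) ×ˢ {l}
    have hmem : ∀ r l, (r, l) ∈ K ↔ t l ≤ r ∧ r ≤ t (l + 1) := fun r l => by simp [K]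
    refine ⟨K, fun r l => Φ (s l) (r - t l), ⟨main K ⟨t, ht0, htm, Or.inl rfl⟩ ?_ ?_,
      not_isBounded_of_forall_mem (t := t) fun l => (hmem _ l).2 ⟨le_rfl, htm (Nat.le_succ l)⟩⟩,
      by simp [ht0, hΦ0, s]⟩
    · intro l r hr
      refine hIoo l r (interior_Icc (a := t l) ▸ interior_mono (fun q hq => ?_) hr)
      exact (hmem q l).1 hq
    · intro r l h1 h2
      rw [hmem] at h1 h2
      exact ⟨le_antisymm h1.2 h2.1, hD l⟩

/-! ### Structure of solutions -/

variable {K : Set (ℝ × ℕ)} {ζ : ℝ → ℕ → W.State}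

theorem eq_flow_of_isSolution (h : W.hystereticSystem.IsSolution K ζ) {a b : ℝ} {l : ℕ}
    (ha : (a, l) ∈ K) (hb : (b, l) ∈ K) (hab : a ≤ b) {φ : ℝ → W.State} (h0 : φ 0 = ζ a l)
    (hφ : ∀ t, HasDerivAt φ (W.flowMap (φ t)) t) : ζ b l = φ (b - a) := by
  obtain ⟨c, hc⟩ := W.exists_lipschitzWith_flowMap
  exact h.eqOn_flow hc ha hb hab (φ := fun t => φ (t - a))
    (fun t => (hφ (t - a)).comp_sub_const t a) (by simp [h0]) (right_mem_Icc.2 hab)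

/-- Induction on the number of jumps: flow keeps `σ`, the jump map preserves `Λ`, and the initial
condition gives the base case because the flow and jump sets together cover exactly `Λ`. -/
theorem mem_Λ_of_isSolution (h : W.hystereticSystem.IsSolution K ζ) (l : ℕ) :
    ∀ t, (t, l) ∈ K → ζ t l ∈ W.Λ := by
  have step : ∀ {a b : ℝ} {l : ℕ}, (a, l) ∈ K → (b, l) ∈ K → a ≤ b → ζ a l ∈ W.Λ →
      ζ b l ∈ W.Λ := by
    intro a b l ha hb hab hΛ
    obtain ⟨φ, h0, hφ⟩ := W.exists_flow (ζ a l)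
    rw [eq_flow_of_isSolution h ha hb hab h0 hφ]
    exact mem_Λ_of_hasDerivAt hφ (s := 0) (by rwa [h0]) _
  induction l with
  | zero =>
    intro t ht
    obtain ⟨h1, h2⟩ := h.domain.zero_mem ht
    exact step h2 ht h1 ((flowSet_union_jumpSet (W := W)) ▸ h.initial)
  | succ l ih =>
    intro t ht
    obtain ⟨s, hst, h1, h2⟩ := h.domain.exists_jump ht
    refine step h2 ht hst ?_
    rw [(h.jump s l h1 h2).2]
    exact jumpMap_mem_Λ (ih s h1)

end PowerNetwork

/-! ### Extending solutions with bounded time domain -/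

namespace PowerNetwork

variable {N : Type*} [Fintype N] [DecidableEq N] {W : PowerNetwork N}
variable {K : Set (ℝ × ℕ)} {ζ : ℝ → ℕ → W.State}

/-- A solution whose last interval `I` can be enlarged while flowing in `C` is not maximal. -/
theorem not_isMaximalSolution_of_flow {t : ℕ → ℝ} (h0 : t 0 = 0) (hm : Monotone t) {J : ℕ}
    {I I' : Set ℝ} (htI : t J ∈ I) (hI : I ⊆ Ici (t J)) (hII : I ⊂ I')
    (hI' : (∃ T, t J ≤ T ∧ I' = Icc (t J) T) ∨ (∃ T, t J < T ∧ I' = Ico (t J) T) ∨ I' = Ici (t J))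
    (hK : K = (⋃ l : ℕ, ⋃ _ : l < J, Icc (t l) (t (l + 1)) ×ˢ {l}) ∪ I ×ˢ {J})
    (h : W.hystereticSystem.IsSolution K ζ) {φ : ℝ → W.State} (hφ0 : φ 0 = ζ (t J) J)
    (hφ : ∀ r, HasDerivAt φ (W.flowMap (φ r)) r)
    (hC : ∀ r ∈ interior I', φ (r - t J) ∈ W.flowSet) :
    ¬ W.hystereticSystem.IsMaximalSolution K ζ := by
  have hmem : ∀ r l, (r, l) ∈ K ↔ (l < J ∧ t l ≤ r ∧ r ≤ t (l + 1)) ∨ (l = J ∧ r ∈ I) :=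
    fun r l => by simp [hK]; tauto
  set K' : Set (ℝ × ℕ) := (⋃ l : ℕ, ⋃ _ : l < J, Icc (t l) (t (l + 1)) ×ˢ {l}) ∪ I' ×ˢ {J}
    with hK'
  have hmem' : ∀ r l, (r, l) ∈ K' ↔ (l < J ∧ t l ≤ r ∧ r ≤ t (l + 1)) ∨ (l = J ∧ r ∈ I') :=
    fun r l => by simp [hK']; tauto
  have hder : ∀ r, HasDerivAt (fun r => φ (r - t J)) (W.flowMap (φ (r - t J))) r :=
    fun r => (hφ (r - t J)).comp_sub_const r (t J)
  obtain ⟨c, hc⟩ := W.exists_lipschitzWith_flowMap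
  have hsub : K ⊆ K' := fun ⟨r, l⟩ hr => by
    rw [hmem] at hr
    exact (hmem' r l).2 (hr.imp_right fun hr => ⟨hr.1, hII.1 hr.2⟩)
  have hslice : ∀ l ≠ J, timeSlice K' l = timeSlice K l := fun l hl => by
    ext r
    simp [timeSlice, hmem, hmem', hl]
  have hsliceJ : timeSlice K' J = I' := by
    ext r
    simp [timeSlice, hmem']
  have hagree : ∀ r l, (r, l) ∈ K → ζ r l = if l = J then φ (r - t J) else ζ r l := by
    intro r l hr
    split_ifs with hl
    · subst hl
      have hrI : r ∈ I := by rw [hmem] at hr; grind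
      exact eq_flow_of_isSolution h ((hmem _ _).2 (Or.inr ⟨rfl, htI⟩)) hr (hI hrI) hφ0 hφ
    · rfl
  rintro ⟨-, hmax⟩
  refine hmax ⟨K', fun r l => if l = J then φ (r - t J) else ζ r l,
    ⟨⟨t, h0, hm, Or.inr ⟨J, I', hI', rfl⟩⟩, fun l a ha b hb hab => ?_, ?_, fun l r hr => ?_,
      fun l hl => ?_, fun r l h1 h2 => ?_⟩, ?_, hagree⟩
  · by_cases hl : l = J
    · simpa only [hl, if_true] using
        absolutelyContinuousOnInterval_of_hasDerivAt hc.continuous hder a b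
    · rw [hslice l hl] at ha hb
      simpa only [hl, if_false] using h.locallyAC l a ha b hb hab
  · have : (0, 0) ∈ K := by
      rw [hmem]
      rcases Nat.eq_zero_or_pos J with rfl | hJ
      · exact Or.inr ⟨rfl, h0 ▸ htI⟩
      · exact Or.inl ⟨hJ, h0.le, h0 ▸ hm (Nat.zero_le 1)⟩
    show (if 0 = J then φ (0 - t J) else ζ 0 0) ∈ _
    rw [← hagree 0 0 this]
    exact h.initial
  · by_cases hl : l = J
    · simp only [hl, if_true]
      subst hl
      exact hC r (hsliceJ ▸ hr)
    · rw [hslice l hl] at hr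
      simpa only [hl, if_false] using h.flow_mem l r hr
  · by_cases hl' : l = J
    · simp only [hl', if_true]
      exact Filter.Eventually.of_forall fun r _ => hder r
    · rw [hslice l hl'] at hl ⊢
      simpa only [hl', if_false] using h.flow_eq l hl
  · have k1 : (r, l) ∈ K := by
      rw [hmem'] at h1 h2
      rw [hmem]
      grind
    -- Enlarging the last interval creates no new jump: one into slice `J` has `r ≤ t J` from slice
    -- `l` and `r ≥ t J` from `I'`, so it happens at `t J`, which is already in `I`.
    have k2 : (r, l + 1) ∈ K := by
      rw [hmem'] at h1 h2
      rw [hmem]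
      rcases h2 with h2 | ⟨h2, h3⟩
      · exact Or.inl h2
      · refine Or.inr ⟨h2, ?_⟩
        have hr : r = t J := by
          subst h2
          refine le_antisymm (by grind) ?_
          obtain ⟨T, -, rfl⟩ | ⟨T, -, rfl⟩ | rfl := hI'
          exacts [h3.1, h3.1, h3]
        exact hr ▸ htI
    simp only [← hagree r l k1, ← hagree r (l + 1) k2]
    exact h.jump r l k1 k2
  · refine ⟨hsub, fun hsub' => ?_⟩
    obtain ⟨r, hr, hr'⟩ := exists_of_ssubset hII
    have := (hmem r J).1 (hsub' ((hmem' r J).2 (Or.inr ⟨rfl, hr⟩)))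
    grind

/-- A solution whose last interval is `[t J, T]` and which ends in `D` is not maximal. -/
theorem not_isMaximalSolution_of_jump {t : ℕ → ℝ} (h0 : t 0 = 0) (hm : Monotone t) {J : ℕ}
    {T : ℝ} (hT : t J ≤ T)
    (hK : K = (⋃ l : ℕ, ⋃ _ : l < J, Icc (t l) (t (l + 1)) ×ˢ {l}) ∪ Icc (t J) T ×ˢ {J})
    (h : W.hystereticSystem.IsSolution K ζ) (hD : ζ T J ∈ W.jumpSet) :
    ¬ W.hystereticSystem.IsMaximalSolution K ζ := by
  have hmem : ∀ r l, (r, l) ∈ K ↔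
      (l < J ∧ t l ≤ r ∧ r ≤ t (l + 1)) ∨ (l = J ∧ t J ≤ r ∧ r ≤ T) :=
    fun r l => by simp [hK]; tauto
  -- With breakpoints constant equal to `T` after index `J`, the old last interval becomes an
  -- ordinary one and the new last slice is `{T}`. Its interior is empty, so it imposes no flow
  -- condition.
  set u : ℕ → ℝ := fun l => if l ≤ J then t l else T with hu
  have hu1 : ∀ l ≤ J, u l = t l := fun l hl => if_pos hl
  have hu2 : ∀ l, J < l → u l = T := fun l hl => if_neg (not_le.2 hl)
  set K' : Set (ℝ × ℕ) :=
    (⋃ l : ℕ, ⋃ _ : l < J + 1, Icc (u l) (u (l + 1)) ×ˢ {l}) ∪ Icc (u (J + 1)) T ×ˢ {J + 1}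
    with hK'
  have hmem' : ∀ r l, (r, l) ∈ K' ↔ (r, l) ∈ K ∨ (l = J + 1 ∧ r = T) := by
    intro r l
    have : (r, l) ∈ K' ↔ (l < J + 1 ∧ u l ≤ r ∧ r ≤ u (l + 1)) ∨
        (l = J + 1 ∧ u (J + 1) ≤ r ∧ r ≤ T) := by simp [hK']; tauto
    rw [this, hmem, hu2 _ (Nat.lt_succ_self J)]
    rcases lt_trichotomy l J with hl | rfl | hl
    · rw [hu1 l hl.le, hu1 (l + 1) hl]
      grind
    · rw [hu1 l le_rfl, hu2 (l + 1) (Nat.lt_succ_self l)]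
      grind
    · grind
  have hdom : IsHybridTimeDomain K' := by
    refine ⟨u, by rw [hu1 0 (Nat.zero_le J), h0], monotone_nat_of_le_succ fun l => ?_,
      Or.inr ⟨J + 1, Icc (u (J + 1)) T, Or.inl ⟨T, (hu2 _ (Nat.lt_succ_self J)).le, rfl⟩, rfl⟩⟩
    rcases lt_trichotomy l J with hl | rfl | hl
    · rw [hu1 l hl.le, hu1 (l + 1) hl]
      exact hm (Nat.le_succ l)
    · rwa [hu1 l le_rfl, hu2 (l + 1) (Nat.lt_succ_self l)]
    · rw [hu2 l hl, hu2 (l + 1) (by omega)]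
  have hnot : ∀ r, (r, J + 1) ∉ K := fun r => by simp [hmem]
  have hslice : ∀ l ≠ J + 1, timeSlice K' l = timeSlice K l := fun l hl => by
    ext r
    simp [timeSlice, hmem', hl]
  have hsliceJ : timeSlice K' (J + 1) = {T} := by
    ext r
    simp [timeSlice, hmem', hnot]
  rintro ⟨-, hmax⟩
  refine hmax ⟨K', fun r l => if l = J + 1 then W.jumpMap (ζ T J) else ζ r l,
    ⟨hdom, fun l a ha b hb hab => ?_, by simpa using h.initial, fun l r hr => ?_,
      fun l hl => ?_, fun r l h1 h2 => ?_⟩, ⟨fun ⟨r, l⟩ hr => (hmem' r l).2 (Or.inl hr),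
        fun hsub => hnot T (hsub ((hmem' _ _).2 (Or.inr ⟨rfl, rfl⟩)))⟩, fun r l hr => ?_⟩
  · by_cases hl : l = J + 1
    · simp only [hl, if_true]
      exact contDiff_const.contDiffOn.absolutelyContinuousOnInterval
    · rw [hslice l hl] at ha hb
      simpa only [hl, if_false] using h.locallyAC l a ha b hb hab
  · by_cases hl : l = J + 1
    · rw [hl, hsliceJ, interior_singleton] at hr
      exact hr.elim
    · rw [hslice l hl] at hr
      simpa only [hl, if_false] using h.flow_mem l r hr
  · by_cases hl' : l = J + 1
    · rw [hl', hsliceJ, interior_singleton] at hl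
      exact absurd hl not_nonempty_empty
    · rw [hslice l hl'] at hl ⊢
      simpa only [hl', if_false] using h.flow_eq l hl
  · have hl : l ≠ J + 1 := by
      rintro rfl
      rw [hmem', hmem] at h2
      grind
    by_cases hl' : l = J
    · subst hl'
      obtain rfl : r = T := by
        rw [hmem'] at h2
        exact (h2.resolve_left (hnot r)).2
      simpa using ⟨hD, rfl⟩
    · have h1' := ((hmem' _ _).1 h1).resolve_right fun h => hl h.1
      have h2' := ((hmem' _ _).1 h2).resolve_right fun h => hl' (by omega)
      simpa [hl, hl'] using h.jump r l h1' h2'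
  · have hl : l ≠ J + 1 := by
      rintro rfl
      exact hnot r hr
    simp [hl]

/-- Every maximal solution is complete. -/
theorem isCompleteSolution_of_isMaximalSolution (hmax : W.hystereticSystem.IsMaximalSolution K ζ) :
    W.hystereticSystem.IsCompleteSolution K ζ := by
  refine ⟨hmax.1, fun hb => ?_⟩
  have h := hmax.1
  obtain ⟨t, h0, hm, hK | ⟨J, I, hI, hK⟩⟩ := h.domain
  · refine not_isBounded_of_forall_mem (t := t) (fun l => ?_) hb
    simp [hK, hm (Nat.le_succ l)]
  have hslice : timeSlice K J = I := by
    ext r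
    simp [timeSlice, hK]
  obtain ⟨φ, hφ0, hφ⟩ := W.exists_flow (ζ (t J) J)
  have hφc : Continuous φ := continuous_iff_continuousAt.2 fun r => (hφ r).continuousAt
  have hI0 : t J ∈ I := by
    obtain ⟨T, h, rfl⟩ | ⟨T, h, rfl⟩ | rfl := hI
    exacts [left_mem_Icc.2 h, left_mem_Ico.2 h, self_mem_Ici]
  have hmemJ : ∀ r ∈ I, (r, J) ∈ K := fun r hr => (show r ∈ timeSlice K J from hslice ▸ hr)
  have hφΛ : ∀ r, φ r ∈ W.Λ := mem_Λ_of_hasDerivAt hφ (s := 0)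
    (hφ0 ▸ mem_Λ_of_isSolution h J _ (hmemJ _ hI0))
  have hφC : ∀ r ∈ interior I, t J ≤ r → φ (r - t J) ∈ W.flowSet := fun r hr hr' => by
    rw [← eq_flow_of_isSolution h (hmemJ _ hI0) (hmemJ _ (interior_subset hr)) hr' hφ0 hφ]
    exact h.flow_mem J r (hslice ▸ hr)
  obtain ⟨T, hT, rfl⟩ | ⟨T, hT, rfl⟩ | rfl := hI
  · by_cases hD : ζ T J ∈ W.jumpSet
    · exact not_isMaximalSolution_of_jump h0 hm hT hK h hD hmax
    · rw [eq_flow_of_isSolution h (hmemJ _ hI0) (hmemJ T (right_mem_Icc.2 hT)) hT hφ0 hφ] at hD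
      -- The neighbourhood also covers `r = T`, where the solution itself is not required to lie in
      -- the flow set.
      have hev : ∀ᶠ r in nhds (T - t J), φ r ∉ W.jumpSet :=
        (isClosed_setOf_mem_jumpSet hφc hφΛ).isOpen_compl.mem_nhds hD
      obtain ⟨ε, hε, hball⟩ := Metric.eventually_nhds_iff.1 hev
      refine not_isMaximalSolution_of_flow h0 hm (I' := Icc (t J) (T + ε)) hI0
        Icc_subset_Ici_self ⟨Icc_subset_Icc_right (by linarith), fun hs => ?_⟩
        (Or.inl ⟨_, by linarith, rfl⟩) hK h hφ0 hφ (fun r hr => ?_) hmax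
      · linarith [(hs (right_mem_Icc.2 (by linarith))).2]
      · rw [interior_Icc] at hr
        rcases lt_or_ge r T with hrT | hrT
        · exact hφC r (by rw [interior_Icc]; exact ⟨hr.1, hrT⟩) hr.1.le
        · refine mem_flowSet_of_notMem_jumpSet (hφΛ _) (hball ?_)
          rw [Real.dist_eq, abs_lt]
          constructor <;> linarith [hr.2]
  -- The global flow supplies a value at `T`, and adding the endpoint leaves the interior unchanged,
  -- so no new flow condition arises.
  · refine not_isMaximalSolution_of_flow h0 hm (I' := Icc (t J) T) hI0
      Ico_subset_Ici_self ⟨Ico_subset_Icc_self, fun hs => ?_⟩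
      (Or.inl ⟨_, hT.le, rfl⟩) hK h hφ0 hφ (fun r hr => ?_) hmax
    · exact lt_irrefl T (hs (right_mem_Icc.2 hT.le)).2
    · rw [interior_Icc] at hr
      exact hφC r (by rwa [interior_Ico]) hr.1.le
  · exact not_isBounded_of_Ici_subset (fun r hr => hmemJ r hr) hb

/-! ### Dwell time -/

-- The jump map changes `σ_j` only at or beyond the threshold matching the direction of the switch,
-- so a switch locates `ω_j`.
omit [Fintype N] [DecidableEq N] in
theorem jumpMap_switching_cases {x : W.State} (hx : x ∈ W.Λ) {j : N}
    (h : State.σ x j ≠ State.σ (W.jumpMap x) j) :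
    State.σ x j = 0 ∧ State.σ (W.jumpMap x) j = 1 ∧ W.ω1 j ≤ State.ω x j ∨
      State.σ x j = 1 ∧ State.σ (W.jumpMap x) j = 0 ∧ State.ω x j ≤ W.ω0 j := by
  have h1 := hx j
  simp only [mem_insert_iff, mem_singleton_iff] at h1
  have h2 : State.σ (W.jumpMap x) j = if W.ω1 j ≤ State.ω x j then 1 else
    if State.ω x j ≤ W.ω0 j then 0 else State.σ x j := rfl
  rw [h2] at h ⊢
  split_ifs at h ⊢ <;> grind

/-- A bounded solution is uniformly Lipschitz in time on its slices. -/
theorem exists_norm_sub_le_of_isBoundedArc (h : W.hystereticSystem.IsSolution K ζ)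
    (hb : IsBoundedArc K ζ) :
    ∃ c : ℝ, 0 < c ∧ ∀ a b l, (a, l) ∈ K → (b, l) ∈ K → a ≤ b →
      ‖ζ b l - ζ a l‖ ≤ c * (b - a) := by
  obtain ⟨L, hL⟩ := W.exists_lipschitzWith_flowMap
  obtain ⟨R, hR⟩ := (hL.isBounded_image hb).exists_norm_le
  -- The maximum with `1` keeps the constant positive, since the dwell time divides by it.
  refine ⟨max R 1, lt_max_of_lt_right one_pos, fun a b l ha hb' hab => ?_⟩
  obtain ⟨φ, hφ0, hφ⟩ := W.exists_flow (ζ a l)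
  have heq : ∀ r ∈ Icc a b, (r, l) ∈ K ∧ ζ r l = φ (r - a) := fun r hr => by
    have hr' : (r, l) ∈ K := (h.domain.ordConnected l).out ha hb' hr
    exact ⟨hr', eq_flow_of_isSolution h ha hr' hr.1 hφ0 hφ⟩
  have := (convex_Icc a b).norm_image_sub_le_of_norm_hasDerivWithin_le
    (f := fun r => φ (r - a)) (C := max R 1)
    (fun r _ => ((hφ (r - a)).comp_sub_const r a).hasDerivWithinAt) (fun r hr => ?_)
    (left_mem_Icc.2 hab) (right_mem_Icc.2 hab)
  · simp only [Real.norm_eq_abs, abs_of_nonneg (sub_nonneg.2 hab)] at this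
    rwa [(heq b (right_mem_Icc.2 hab)).2, (heq a (left_mem_Icc.2 hab)).2]
  · refine (hR _ ?_).trans (le_max_left _ _)
    rw [← (heq r hr).2]
    exact mem_image_of_mem _ ⟨(r, l), (heq r hr).1, rfl⟩

/-- As long as load `j` does not switch, `σ_j` is constant, and `ω_j` is Lipschitz in time across
jumps if the solution is bounded. -/
theorem exists_frequency_bound (h : W.hystereticSystem.IsSolution K ζ) (hb : IsBoundedArc K ζ) :
    ∃ c : ℝ, 0 < c ∧ ∀ j s l, (s, l) ∈ K → (s, l + 1) ∈ K → ∀ m, l + 1 ≤ m →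
      (∀ k r, l < k → k < m → ¬ IsSwitch K ζ j r k) → ∀ t, (t, m) ∈ K →
        State.σ (ζ t m) j = State.σ (ζ s (l + 1)) j ∧
        |State.ω (ζ t m) j - State.ω (ζ s (l + 1)) j| ≤ c * (t - s) := by
  obtain ⟨c, hc, hbound⟩ := exists_norm_sub_le_of_isBoundedArc h hb
  have flow : ∀ j a b l, (a, l) ∈ K → (b, l) ∈ K → a ≤ b →
      State.σ (ζ b l) j = State.σ (ζ a l) j ∧
        |State.ω (ζ b l) j - State.ω (ζ a l) j| ≤ c * (b - a) := by
    intro j a b l ha hb' hab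
    refine ⟨?_, ?_⟩
    · obtain ⟨φ, hφ0, hφ⟩ := W.exists_flow (ζ a l)
      rw [eq_flow_of_isSolution h ha hb' hab hφ0 hφ, ← hφ0]
      exact congrFun (switching_eq_of_hasDerivAt hφ _ _) j
    · calc |State.ω (ζ b l) j - State.ω (ζ a l) j|
          = ‖(ζ b l - ζ a l).1.2.1 j‖ := rfl
        _ ≤ ‖(ζ b l - ζ a l).1.2.1‖ := norm_le_pi_norm _ j
        _ ≤ ‖(ζ b l - ζ a l).1.2‖ := norm_fst_le _
        _ ≤ ‖(ζ b l - ζ a l).1‖ := norm_snd_le _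
        _ ≤ ‖ζ b l - ζ a l‖ := norm_fst_le _
        _ ≤ c * (b - a) := hbound a b l ha hb' hab
  refine ⟨c, hc, fun j s l hs hs' m hm => ?_⟩
  induction m, hm using Nat.le_induction with
  | base => exact fun _ t ht => flow j s t (l + 1) hs' ht (h.domain.le_of_jump hs ht)
  | succ m hm ih =>
    intro hno t ht
    obtain ⟨r, hrt, hr, hr'⟩ := h.domain.exists_jump ht
    obtain ⟨h1, h2⟩ := ih (fun k q hk hk' => hno k q hk (by omega)) r hr
    obtain ⟨h3, h4⟩ := flow j r t (m + 1) hr' ht hrt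
    have h5 : State.σ (ζ r m) j = State.σ (ζ r (m + 1)) j := by
      by_contra hne
      exact hno m r hm (Nat.lt_succ_self m) ⟨hr, hr', hne⟩
    -- Jumps leave `x` unchanged, so the slice estimates add up across them.
    have h6 : State.ω (ζ r (m + 1)) j = State.ω (ζ r m) j := by
      rw [(h.jump r m hr hr').2]; rfl
    rw [h6] at h4
    refine ⟨by rw [h3, ← h5, h1], ?_⟩
    calc _ ≤ |State.ω (ζ t (m + 1)) j - State.ω (ζ r m) j|
          + |State.ω (ζ r m) j - State.ω (ζ s (l + 1)) j| := abs_sub_le _ _ _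
      _ ≤ c * (t - s) := by linarith

/-- Along a bounded solution the switches of every load have a positive dwell time. -/
theorem exists_dwell_time (h : W.hystereticSystem.IsSolution K ζ) (hb : IsBoundedArc K ζ) (j : N) :
    ∃ τ : ℝ, 0 < τ ∧ ∀ s t : ℝ, AreConsecutiveSwitchTimes K ζ j s t → τ ≤ t - s := by
  obtain ⟨c, hc, hbound⟩ := exists_frequency_bound h hb
  -- Width of the hysteresis band divided by the bound on the speed of `ω_j`.
  refine ⟨(W.ω1 j - W.ω0 j) / c, div_pos (sub_pos.2 (W.ω0_lt_ω1 j)) hc, ?_⟩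
  rintro s t ⟨l, m, hlm, ⟨hs, hs', hsne⟩, ⟨ht, ht', htne⟩, hno⟩
  obtain ⟨hσ, hω⟩ := hbound j s l hs hs' m hlm hno t ht
  rw [(h.jump s l hs hs').2] at hsne hσ hω
  rw [(h.jump t m ht ht').2] at htne
  have h1 := jumpMap_switching_cases (mem_Λ_of_isSolution h l s hs) hsne
  have h2 := jumpMap_switching_cases (mem_Λ_of_isSolution h m t ht) htne
  change State.σ (ζ t m) j = State.σ (W.jumpMap (ζ s l)) j at hσ
  change |State.ω (ζ t m) j - State.ω (ζ s l) j| ≤ c * (t - s) at hω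
  rw [div_le_iff₀ hc]
  rw [abs_le] at hω
  -- Two switches in the same direction contradict the constancy of `σ_j` in between; opposite ones
  -- put `ω_j` at or beyond opposite thresholds.
  rcases h1 with ⟨-, h1, h3⟩ | ⟨-, h1, h3⟩ <;> rcases h2 with ⟨h2, -, h4⟩ | ⟨h2, -, h4⟩
  · norm_num [h1, h2] at hσ
  · linarith [hω.1]
  · linarith [hω.2]
  · norm_num [h1, h2] at hσ

end PowerNetwork

theorem mainTheorem9 {N : Type*} [Fintype N] [DecidableEq N] (W : PowerNetwork N) :
    (∀ ζ₀ ∈ W.Λ, ∃ (K : Set (ℝ × ℕ)) (ζ : ℝ → ℕ → W.State),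
      W.hystereticSystem.IsCompleteSolution K ζ ∧ ζ 0 0 = ζ₀) ∧
    (∀ (K : Set (ℝ × ℕ)) (ζ : ℝ → ℕ → W.State),
      W.hystereticSystem.IsMaximalSolution K ζ → W.hystereticSystem.IsCompleteSolution K ζ) ∧
    (∀ (K : Set (ℝ × ℕ)) (ζ : ℝ → ℕ → W.State),
      W.hystereticSystem.IsCompleteSolution K ζ → IsBoundedArc K ζ →
        ∀ j : N, ∃ τ : ℝ, 0 < τ ∧
          ∀ s t : ℝ, PowerNetwork.AreConsecutiveSwitchTimes K ζ j s t → τ ≤ t - s) :=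
  ⟨fun _ h => PowerNetwork.exists_isCompleteSolution h,
    fun _ _ h => PowerNetwork.isCompleteSolution_of_isMaximalSolution h,
    fun _ _ h hb j => PowerNetwork.exists_dwell_time h.1 hb j⟩
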